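/- Let $n,k\ge 1$ and $m\ge 0$ (for a vector autoregression with $p$ lags and a constant, $m=np+1$). Structural parameters are pairs $A=(A_0,A_+)$ with $A_0\in\mathbb R^{n\times n}$ invertible and $A_+\in\mathbb R^{m\times n}$; their set is $\mathbb P^S$. Reduced-form parameters are pairs $(B,\Sigma)$ with $B\in\mathbb R^{m\times n}$ and $\Sigma\in\mathbb R^{n\times n}$ symmetric positive definite; their set is $\mathbb P^R$, an open subset of $\mathbb R^{nm+n(n+1)/2}$ (coordinates: the entries of $B$ and the entries of $\Sigma$ on and below the diagonal). Put $g(A_0,A_+)=(A_+A_0^{-1},(A_0A_0')^{-1})$ and, for a matrix $P\in\mathbb R^{n\times n}$, $AP=(A_0P,A_+P)$. Let $U\subset\mathbb P^S$ and $f:U\to\mathbb R^{k\times n}$. Assume that $f$ is admissible ($AP\in U$ and $f(AP)=f(A)P$ for all $A\in U$ and all orthogonal $P$) and regular ($U$ is open and $f$ is continuously differentiable with derivative of rank $kn$ at every point of $U$). Let $N\subset\mathbb P^S$ be a normalization rule, i.e. for every $A\in\mathbb P^S$ there is exactly one diagonal matrix $D$ with diagonal entries $\pm1$ such that $AD\in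 N$. Let $Q_1,\dots,Q_n\in\mathbb R^{k\times k}$ have ranks $q_j=\operatorname{rank}Q_j=n-j$, and put $$R=\{A\in U\cap N:\ Q_jf(A)e_j=0\ \text{ for } j=1,\dots,n\},\qquad \tilde{\mathbb P}^R=g(R)\subset\mathbb P^R .$$ For $(B,\Sigma)\in\tilde{\mathbb P}^R$ let $\Sigma=\Sigma_{tr}\Sigma_{tr}'$ be the Cholesky decomposition ($\Sigma_{tr}$ lower triangular with positive diagonal), let $A$ be given by $A_0'=\Sigma_{tr}^{-1}$ and $A_+=B(\Sigma_{tr}^{-1})'$, and let unit vectors $p_1,\dots,p_n\in\mathbb R^n$ be constructed successively so that $\tilde Q_jp_j=0$, where $\tilde Q_j$ is the matrix whose rows are those of $Q_jf(A)$ followed by $p_1',\dots,p_{j-1}'$. This construction is possible at every point of $\tilde{\mathbb P}^R$. Fix any choice of the vectors $p_1,\dots,p_n$ at each $(B,\Sigma)\in\tilde{\mathbb P}^R$. Let $K$ be the set of $(B,\Sigma)\in\tilde{\mathbb P}^R$ at which the restrictions are non-redundant, i.e. for every $j=2,\dots,n$ the matrix $\tilde Q_j$, with $Q_j$ reduced to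 $q_j$ linearly independent rows, has full row rank: $\operatorname{rank}\tilde Q_j=q_j+(j-1)$. Then either $K$ is empty or $\tilde{\mathbb P}^R\setminus K$ has Lebesgue measure zero. The same holds with $K$ replaced by the set $K'$ of those $(B,\Sigma)\in\tilde{\mathbb P}^R$ at which $\operatorname{rank}\tilde Q_j=n-1$ for all $j=1,\dots,n$. -/

import Mathlib

open scoped Matrix Matrix.Norms.Elementwise

noncomputable section

namespace SVAR

/-- Structural parameters `(A₀, A₊)`, with `A₀` of size `n × n` and `A₊` of size `m × n`. -/
abbrev StructParam (n m : ℕ) : Type :=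
  Matrix (Fin n) (Fin n) ℝ × Matrix (Fin m) (Fin n) ℝ

/-- Reduced-form parameters `(B, Σ)`, with `B` of size `m × n` and `Σ` of size `n × n`. That `Σ` is
symmetric positive definite is not part of the type, but it holds for all values of `toReduced`. -/
abbrev RedParam (n m : ℕ) : Type :=
  Matrix (Fin m) (Fin n) ℝ × Matrix (Fin n) (Fin n) ℝ

/-- The set of structural parameters: `A₀` is invertible. -/
def structSet (n m : ℕ) : Set (StructParam n m) := {A | IsUnit A.1}

/-- `(A₀, A₊) ↦ (A₊ A₀⁻¹, (A₀ A₀')⁻¹)`. -/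
def toReduced {n m : ℕ} (A : StructParam n m) : RedParam n m :=
  (A.2 * A.1⁻¹, (A.1 * A.1ᵀ)⁻¹)

/-- `(A₀, A₊) ↦ (A₀ P, A₊ P)`. -/
def rotate {n m : ℕ} (A : StructParam n m) (P : Matrix (Fin n) (Fin n) ℝ) : StructParam n m :=
  (A.1 * P, A.2 * P)

/-- Admissibility of the transformation `f` with domain `U`: for every orthogonal `P` and every
`(A₀, A₊) ∈ U`, `f (A₀ P, A₊ P)` is defined and equal to `f (A₀, A₊) P`. -/
def Admissible {n m k : ℕ} (U : Set (StructParam n m))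
    (f : StructParam n m → Matrix (Fin k) (Fin n) ℝ) : Prop :=
  ∀ P ∈ Matrix.orthogonalGroup (Fin n) ℝ, ∀ A ∈ U,
    rotate A P ∈ U ∧ f (rotate A P) = f A * P

/-- Regularity of the transformation `f` with domain `U`: `U` is open and `f` is continuously
differentiable on `U` with derivative of rank `k n` at every point of `U`. -/
structure Regular {n m k : ℕ} (U : Set (StructParam n m))
    (f : StructParam n m → Matrix (Fin k) (Fin n) ℝ) : Prop where
  isOpen : IsOpen U
  contDiffOn : ContDiffOn ℝ 1 f U
  rank_deriv : ∀ A ∈ U,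
    Module.finrank ℝ (fderiv ℝ f A).toLinearMap.range = k * n

/-- A normalization rule: a set `N` of structural parameters such that every structural parameter
is moved into `N` by exactly one diagonal matrix with entries `±1` on the diagonal. -/
def IsNormalization {n m : ℕ} (N : Set (StructParam n m)) : Prop :=
  N ⊆ structSet n m ∧
    ∀ A ∈ structSet n m, ∃! d : Fin n → ℝ,
      (∀ i, d i = 1 ∨ d i = -1) ∧ rotate A (Matrix.diagonal d) ∈ N

/-- The set `R` of restricted structural parameters: those in `U ∩ N` that satisfy
`Q_j f(A₀, A₊) e_j = 0` for all `j`. -/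
def restrictedSet {n m k : ℕ} (U N : Set (StructParam n m))
    (f : StructParam n m → Matrix (Fin k) (Fin n) ℝ)
    (Q : Fin n → Matrix (Fin k) (Fin k) ℝ) : Set (StructParam n m) :=
  {A | A ∈ U ∩ N ∧ ∀ j, (Q j * f A) *ᵥ Pi.single j 1 = 0}

/-- The set of reduced-form parameters generated by the structural parameters in `R`. -/
def generatedSet {n m k : ℕ} (U N : Set (StructParam n m))
    (f : StructParam n m → Matrix (Fin k) (Fin n) ℝ)
    (Q : Fin n → Matrix (Fin k) (Fin k) ℝ) : Set (RedParam n m) :=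
  toReduced '' restrictedSet U N f Q

/-- `L` is a lower triangular Cholesky factor of `S`, with positive diagonal. -/
structure IsCholesky {n : ℕ} (L S : Matrix (Fin n) (Fin n) ℝ) : Prop where
  lower : ∀ i j, i < j → L i j = 0
  diag_pos : ∀ i, 0 < L i i
  mul_transpose : L * Lᵀ = S

theorem exists_isCholesky {n : ℕ} {S : Matrix (Fin n) (Fin n) ℝ} (hS : S.PosDef) :
    ∃ L, IsCholesky L S := by
  set M := LDL.lowerInv hS with hM
  set L := LDL.lower hS with hL
  have hMtri : M.BlockTriangular OrderDual.toDual := by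
    intro i j hij
    exact LDL.lowerInv_triangular hS hij
  have hLtri : L.BlockTriangular OrderDual.toDual := by
    have : Invertible M := LDL.invertibleLowerInv hS
    exact Matrix.blockTriangular_inv_of_blockTriangular hMtri
  have hLdet : L.det ≠ 0 := by
    have : Invertible M := LDL.invertibleLowerInv hS
    have h : IsUnit (M⁻¹) := by
      rw [Matrix.isUnit_nonsing_inv_iff]
      exact isUnit_of_invertible M
    exact ((Matrix.isUnit_iff_isUnit_det _).1 h).ne_zero
  have hLdiag : ∀ i, L i i ≠ 0 := by
    rw [Matrix.det_of_isLowerTriangular L hLtri, Finset.prod_ne_zero_iff] at hLdet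
    exact fun i => hLdet i (Finset.mem_univ i)
  have hD : ∀ i, 0 < LDL.diagEntries hS i := by
    have h : (LDL.diag hS).PosDef := by
      rw [LDL.diag_eq_lowerInv_conj]
      have : Invertible M := LDL.invertibleLowerInv hS
      exact hS.mul_mul_conjTranspose_same
        (Matrix.vecMul_injective_of_isUnit (isUnit_of_invertible M))
    exact Matrix.posDef_diagonal_iff.1 h
  have hs : ∀ x : ℝ, x ≠ 0 → (SignType.sign x : ℝ) * SignType.sign x = 1 := by
    intro x hx
    rcases lt_or_gt_of_ne hx with h | h <;> simp [h]
  refine ⟨L * Matrix.diagonal fun i => (SignType.sign (L i i) : ℝ) *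
    √(LDL.diagEntries hS i), ?_, ?_, ?_⟩
  · intro i j hij
    rw [Matrix.mul_diagonal, hLtri hij, zero_mul]
  · intro i
    rw [Matrix.mul_diagonal, ← mul_assoc]
    refine mul_pos ?_ (Real.sqrt_pos.2 (hD i))
    rw [self_mul_sign]
    exact abs_pos.2 (hLdiag i)
  · conv_rhs => rw [← LDL.lower_conj_diag hS]
    rw [Matrix.transpose_mul, Matrix.diagonal_transpose, Matrix.mul_assoc,
      ← Matrix.mul_assoc (Matrix.diagonal _), Matrix.diagonal_mul_diagonal, LDL.diag,
      Matrix.conjTranspose_eq_transpose_of_trivial, Matrix.mul_assoc]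
    congr 4
    funext i
    rw [mul_mul_mul_comm, hs _ (hLdiag i), one_mul, Real.mul_self_sqrt (hD i).le]

open Classical in
/-- The lower triangular Cholesky factor of `S` (which exists if `S` is positive definite, and the
identity otherwise). -/
def choleskyFactor {n : ℕ} (S : Matrix (Fin n) (Fin n) ℝ) : Matrix (Fin n) (Fin n) ℝ :=
  if h : ∃ L, IsCholesky L S then h.choose else 1

theorem isCholesky_choleskyFactor {n : ℕ} {S : Matrix (Fin n) (Fin n) ℝ} (hS : S.PosDef) :
    IsCholesky (choleskyFactor S) S := by
  have h := exists_isCholesky hS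
  rw [choleskyFactor, dif_pos h]
  exact h.choose_spec

/-- The triangular structural parameter of `(B, Σ)`: with `L` the Cholesky factor of `Σ`,
`A₀' = L⁻¹` and `A₊ = B (L⁻¹)'`. -/
def triangularParam {n m : ℕ} (θ : RedParam n m) : StructParam n m :=
  ((choleskyFactor θ.2)⁻¹ᵀ, θ.1 * (choleskyFactor θ.2)⁻¹ᵀ)

/-- The matrix with rows those of `Q_j X`, followed by `p_i'` for the indices `i` before `j`, where
`p_i` is the `i`-th column of `P`. -/
def qTilde {n k : ℕ} (Q : Fin n → Matrix (Fin k) (Fin k) ℝ) (X : Matrix (Fin k) (Fin n) ℝ)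
    (P : Matrix (Fin n) (Fin n) ℝ) (j : Fin n) :
    Matrix (Fin k ⊕ {i : Fin n // i < j}) (Fin n) ℝ :=
  Matrix.fromRows (Q j * X) (Matrix.of fun i => P.col i.1)

/-- The columns `p_1, …, p_n` of `P` are obtained by successively choosing a unit vector `p_j` with
`Q̃_j p_j = 0`. Since `Q̃_j` contains the rows `p_1', …, p_{j-1}'`, they are orthonormal. -/
def IsSequentialSolution {n k : ℕ} (Q : Fin n → Matrix (Fin k) (Fin k) ℝ)
    (X : Matrix (Fin k) (Fin n) ℝ) (P : Matrix (Fin n) (Fin n) ℝ) : Prop :=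
  ∀ j, qTilde Q X P j *ᵥ P.col j = 0 ∧ P.col j ⬝ᵥ P.col j = 1

/-- Non-redundancy for given `p_1, …, p_n`: for `j = 2, …, n`, the matrix `Q̃_j` is of full row rank
when `Q_j` is reduced to `q_j = rank Q_j` rows, that is, its rank is `q_j + (j - 1)`. The index `j`
of the text is `j + 1` here. -/
def NonRedundant {n k : ℕ} (Q : Fin n → Matrix (Fin k) (Fin k) ℝ)
    (X : Matrix (Fin k) (Fin n) ℝ) (P : Matrix (Fin n) (Fin n) ℝ) : Prop :=
  ∀ j : Fin n, 0 < j.val → (qTilde Q X P j).rank = (Q j).rank + j.val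

/-- The rank conditions `rank Q̃_j = n - 1` for all `j = 1, …, n`. -/
def FullRankConditions {n k : ℕ} (Q : Fin n → Matrix (Fin k) (Fin k) ℝ)
    (X : Matrix (Fin k) (Fin n) ℝ) (P : Matrix (Fin n) (Fin n) ℝ) : Prop :=
  ∀ j : Fin n, (qTilde Q X P j).rank = n - 1

/-- The set `K` of generated reduced-form parameters at which the restrictions are non-redundant,
where `P θ` holds the vectors `p_1, …, p_n` that are used at `θ`. -/
def nonRedundantSet {n m k : ℕ} (U N : Set (StructParam n m))
    (f : StructParam n m → Matrix (Fin k) (Fin n) ℝ)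
    (Q : Fin n → Matrix (Fin k) (Fin k) ℝ)
    (P : RedParam n m → Matrix (Fin n) (Fin n) ℝ) : Set (RedParam n m) :=
  {θ ∈ generatedSet U N f Q | NonRedundant Q (f (triangularParam θ)) (P θ)}

/-- The set `K'` of generated reduced-form parameters at which `rank Q̃_j = n - 1` for all
`j = 1, …, n`, where `P θ` holds the vectors `p_1, …, p_n` that are used at `θ`. -/
def fullRankSet {n m k : ℕ} (U N : Set (StructParam n m))
    (f : StructParam n m → Matrix (Fin k) (Fin n) ℝ)
    (Q : Fin n → Matrix (Fin k) (Fin k) ℝ)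
    (P : RedParam n m → Matrix (Fin n) (Fin n) ℝ) : Set (RedParam n m) :=
  {θ ∈ generatedSet U N f Q | FullRankConditions Q (f (triangularParam θ)) (P θ)}

/-- Coordinates of a reduced-form parameter in `ℝ ^ (n m + n (n + 1) / 2)`: the entries of `B`, and
the entries of `Σ` on and below the diagonal. -/
def redCoords {n m : ℕ} (θ : RedParam n m) :
    (Fin m × Fin n) ⊕ {q : Fin n × Fin n // q.2 ≤ q.1} → ℝ :=
  Sum.elim (fun q => θ.1 q.1 q.2) (fun q => θ.2 q.1.1 q.1.2)

/-- Lebesgue measure zero, in the coordinates `redCoords`. -/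
def IsNull {n m : ℕ} (s : Set (RedParam n m)) : Prop :=
  MeasureTheory.volume (redCoords '' s) = 0

end SVAR

end

/-! Since `q_j + (j - 1) = n - 1`, non-redundancy says that the kernel of `Q̃_j` is the line through
`p_j`. Reduce `Q_j` to a row basis, put into the rows `i > j` of a matrix `S_j`. Then let `v_j(X)`
be the generalized cross product of `v_1, …, v_{j-1}` and the rows `i > j` of `S_j X` (`crossVec`).
It is polynomial in `X`. If no `v_j(X)` vanishes, each `p_j` is a nonzero multiple of `v_j(X)` and
all rank conditions hold, whatever the choice of the `p_j`. So failures occur only over the closed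
set `Z` of those `X` with some `v_j(X) = 0`.

Either `Z` is everything or it is null, because a line through a point outside `Z` meets `Z` in
finitely many points. A point of `K` or of `K'` excludes the first case
(`exists_forall_crossVec_ne_zero`). For `K` this needs a perturbation: nothing is known about `rank
Q̃_1`, so `v_1` may vanish at the given `X`. Along a suitable line `X + tY`, `p_1` remains a
solution and `v_1` is nonzero for small `t ≠ 0`. By induction, multiples of `v_j(X + tY)` tend to
`p_j ≠ 0`.

It remains to carry nullity from values of `f` to reduced forms. By admissibility, `f(A)` and the
value of `f` at the triangular parameter differ by an orthogonal matrix, which preserves the rank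
conditions. Hence a structural parameter in `U` over a bad reduced form has its value under `f` in
`Z`. Both `f` and the reduced-form map are submersions: the preimage of `Z` under `f` is locally
null, and a set whose preimage under a submersion is locally null is locally null
(`exists_nhds_volume_inter_eq_zero`). -/

namespace SVAR

/-! ### Null sets under submersions. -/

open MeasureTheory Filter Topology Set Pointwise

/-- A closed set that meets every line through some point in a countable set is null. -/
theorem addHaar_eq_zero_of_countable_line_inter {F : Type*} [NormedAddCommGroup F]
    [NormedSpace ℝ F] [FiniteDimensional ℝ F] [MeasurableSpace F] [BorelSpace F]
    (μ : Measure F) [μ.IsAddHaarMeasure] {Z : Set F} (hZ : IsClosed Z) (x : F)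
    (h : ∀ y, {t : ℝ | x + t • y ∈ Z}.Countable) : μ Z = 0 := by
  have hS : IsClosed {q : F × ℝ | x + q.2 • q.1 ∈ Z} := hZ.preimage (by fun_prop)
  have h0 : (μ.prod volume) {q : F × ℝ | x + q.2 • q.1 ∈ Z} = 0 := by
    rw [Measure.measure_prod_null hS.measurableSet]
    exact Eventually.of_forall fun y => (h y).measure_zero _
  have h1 : (volume.prod μ) {q : ℝ × F | x + q.1 • q.2 ∈ Z} = 0 := by
    rw [← Measure.prod_swap, Measure.map_apply measurable_swap] at h0
    · exact h0
    · exact hS.measurableSet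
  have h2 := Measure.measure_ae_null_of_prod_null h1
  -- By Fubini almost every `t` has a null slice. For one such `t ≠ 0`, `Z` is the image of the
  -- slice under the bijection `y ↦ x + t • y`.
  obtain ⟨t, ht, ht0⟩ := (h2.and (Measure.ae_ne volume 0)).exists
  have hZt : Z = (fun y => x + y) '' (t • {y : F | x + t • y ∈ Z}) := by
    ext z
    constructor
    · intro hz
      refine ⟨z - x, ⟨t⁻¹ • (z - x), ?_, ?_⟩, by simp⟩
      · simpa [smul_smul, ht0] using hz
      · simp [smul_smul, ht0]
    · rintro ⟨_, ⟨y, hy, rfl⟩, rfl⟩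
      exact hy
  rw [hZt, image_add_left, measure_preimage_add, Measure.addHaar_smul]
  have : μ {y | x + t • y ∈ Z} = 0 := ht
  rw [this, mul_zero]

/-- A submersion at `a` is, near `a`, the composition of its derivative with a local
diffeomorphism whose derivative at `a` is the identity. -/
theorem exists_hasStrictFDerivAt_id_comp_eq {E F : Type*} [NormedAddCommGroup E]
    [NormedSpace ℝ E] [NormedAddCommGroup F] [NormedSpace ℝ F] [FiniteDimensional ℝ F]
    {f : E → F} {f' : E →L[ℝ] F} {a : E} (hf : HasStrictFDerivAt f f' a)
    (hf' : Function.Surjective f') :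
    ∃ Ψ : E → E, HasStrictFDerivAt Ψ (ContinuousLinearMap.id ℝ E) a ∧ ∀ x, f' (Ψ x) = f x := by
  obtain ⟨σ, hσ⟩ := f'.toLinearMap.exists_rightInverse_of_surjective
    (LinearMap.range_eq_top.2 hf')
  let τ : F →L[ℝ] E := LinearMap.toContinuousLinearMap σ
  have hτ : ∀ y, f' (τ y) = y := fun y => LinearMap.congr_fun hσ y
  refine ⟨fun x => x + τ (f x - f' x), ?_, fun x => ?_⟩
  · have h := (hasStrictFDerivAt_id a).add
      (τ.hasStrictFDerivAt.comp a (hf.sub f'.hasStrictFDerivAt))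
    rw [sub_self, ContinuousLinearMap.comp_zero, add_zero] at h
    exact h
  · simp [hτ]

/-- `B` need not be measurable, so the almost-everywhere statement is applied to its measurable
hull. This matters because the vectors `p_j` are chosen arbitrarily at each point. -/
theorem _root_.LinearMap.addHaar_preimage_eq_zero {E F : Type*} [NormedAddCommGroup E]
    [NormedSpace ℝ E] [FiniteDimensional ℝ E] [MeasurableSpace E] [BorelSpace E]
    [NormedAddCommGroup F] [NormedSpace ℝ F] [MeasurableSpace F] [BorelSpace F]
    (μ : Measure E) [μ.IsAddHaarMeasure] (ν : Measure F) [ν.IsAddHaarMeasure] {L : E →ₗ[ℝ] F} (hL : Function.Surjective L) {B : Set F} (hB : ν B = 0) : μ (L ⁻¹' B) = 0 := by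
  have h := (ae_comp_linearMap_mem_iff L μ ν hL (measurableSet_toMeasurable ν B).compl).2
    (by rw [ae_iff]; simpa using hB)
  refine measure_mono_null (fun x hx => ?_) (ae_iff.1 h)
  simpa using subset_toMeasurable ν B hx

section Submersion

variable {E F : Type*} [NormedAddCommGroup E] [NormedSpace ℝ E] [FiniteDimensional ℝ E]
  [MeasurableSpace E] [BorelSpace E] [NormedAddCommGroup F] [NormedSpace ℝ F]
  [FiniteDimensional ℝ F] [MeasurableSpace F] [BorelSpace F]
  (μ : Measure E) [μ.IsAddHaarMeasure] (ν : Measure F) [ν.IsAddHaarMeasure]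

theorem _root_.LinearMap.addHaar_eq_zero_of_preimage {L : E →ₗ[ℝ] F}
    (hL : Function.Surjective L) {B : Set F} (hB : μ (L ⁻¹' B) = 0) : ν B = 0 := by
  obtain ⟨σ, hσ⟩ := L.exists_rightInverse_of_surjective (LinearMap.range_eq_top.2 hL)
  have hσ' : ∀ y, L (σ y) = y := fun y => LinearMap.congr_fun hσ y
  -- `M (y, x) = σ y + (x - σ (L x))` satisfies `L (M (y, x)) = y`, so the preimage of `L ⁻¹' B`
  -- under `M` is the cylinder over `B`.
  let M : F × E →ₗ[ℝ] E := σ.coprod (LinearMap.id - σ ∘ₗ L)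
  have hM : Function.Surjective M := fun x => ⟨(L x, x), by simp [M]⟩
  have h := M.addHaar_preimage_eq_zero (ν.prod μ) μ hM hB
  have hpre : M ⁻¹' (L ⁻¹' B) = B ×ˢ univ := by
    ext q
    simp [M, hσ']
  rw [hpre, Measure.prod_prod, mul_eq_zero] at h
  exact h.resolve_right (NeZero.ne _)

/-- Near `a` the map `Ψ` shrinks outer measure at most by the factor `1/2`, and it sends `f ⁻¹' B`
into the null set `f' ⁻¹' B`. -/
theorem exists_nhds_addHaar_inter_preimage_eq_zero {f : E → F} {f' : E →L[ℝ] F} {a : E}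
    (hf : HasStrictFDerivAt f f' a) (hf' : Function.Surjective f') {B : Set F} (hB : ν B = 0) :
    ∃ s ∈ 𝓝 a, μ (s ∩ f ⁻¹' B) = 0 := by
  obtain ⟨Ψ, hΨ, hfΨ⟩ := exists_hasStrictFDerivAt_id_comp_eq hf hf'
  obtain ⟨δ, hδ, hδ0⟩ := ((mul_le_addHaar_image_of_lt_det μ (ContinuousLinearMap.id ℝ E)
    (m := 2⁻¹) (by simp [ContinuousLinearMap.det, ENNReal.inv_lt_one])).and
      self_mem_nhdsWithin).exists
  obtain ⟨s, hs, happ⟩ := hΨ.approximates_deriv_on_nhds (Or.inr hδ0)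
  refine ⟨s, hs, ?_⟩
  have h1 := hδ _ _ (happ.mono_set (inter_subset_left (t := f ⁻¹' B)))
  have h2 : μ (Ψ '' (s ∩ f ⁻¹' B)) = 0 := by
    refine measure_mono_null ?_ (f'.toLinearMap.addHaar_preimage_eq_zero μ ν hf' hB)
    rintro _ ⟨x, hx, rfl⟩
    simpa [hfΨ] using hx.2
  rw [h2] at h1
  simpa using h1

/-- The converse transfer: `Ψ` at most doubles outer measure near `a`, which reduces the claim to
the linear map `g'`. -/
theorem exists_nhds_addHaar_inter_eq_zero {g : E → F} {g' : E →L[ℝ] F} {a : E}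
    (hg : HasStrictFDerivAt g g' a) (hg' : Function.Surjective g') {W : Set F} {s : Set E}
    (hs : s ∈ 𝓝 a) (hW : μ (s ∩ g ⁻¹' W) = 0) : ∃ V ∈ 𝓝 (g a), ν (V ∩ W) = 0 := by
  obtain ⟨Ψ, hΨ, hgΨ⟩ := exists_hasStrictFDerivAt_id_comp_eq hg hg'
  obtain ⟨δ, hδ, hδ0⟩ := ((addHaar_image_le_mul_of_det_lt μ (ContinuousLinearMap.id ℝ E)
    (m := 2) (by simp [ContinuousLinearMap.det])).and self_mem_nhdsWithin).exists
  obtain ⟨t, ht, happ⟩ := hΨ.approximates_deriv_on_nhds (Or.inr hδ0)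
  have hnull : μ (Ψ '' ((s ∩ t) ∩ g ⁻¹' W)) = 0 := by
    have h1 := hδ _ _ (happ.mono_set (s := (s ∩ t) ∩ g ⁻¹' W) fun x hx => hx.1.2)
    have h2 : μ ((s ∩ t) ∩ g ⁻¹' W) = 0 :=
      measure_mono_null (inter_subset_inter_left _ inter_subset_left) hW
    rw [h2, mul_zero] at h1
    exact le_antisymm h1 zero_le
  -- `O` is an open neighbourhood of `Ψ a` whose intersection with `g' ⁻¹' W` is null
  have hO : Ψ '' (s ∩ t) ∈ 𝓝 (Ψ a) := by
    rw [← hΨ.map_nhds_eq_of_surj (LinearMap.range_eq_top.2 Function.surjective_id)]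
    exact image_mem_map (inter_mem hs ht)
  obtain ⟨O, hOsub, hOo, haO⟩ := mem_nhds_iff.1 hO
  have hOnull : μ (O ∩ g' ⁻¹' W) = 0 := by
    refine measure_mono_null ?_ hnull
    rintro y ⟨hy, hyW⟩
    obtain ⟨x, hx, rfl⟩ := hOsub hy
    exact ⟨x, ⟨hx, by simpa [hgΨ] using hyW⟩, rfl⟩
  have hopen : IsOpenMap g' := g'.isOpenMap hg'
  refine ⟨g' '' O, (hopen O hOo).mem_nhds ⟨Ψ a, haO, hgΨ a⟩, ?_⟩
  -- by invariance under translations along `ker g'`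
  have hpre : μ (g' ⁻¹' (g' '' O ∩ W)) = 0 := by
    refine measure_null_of_locally_null _ fun y hy => ?_
    obtain ⟨v, hv, hvy⟩ := hy.1
    have hvO : v - y + y ∈ O := by simpa using hv
    refine ⟨(fun z => (v - y) + z) ⁻¹' O ∩ g' ⁻¹' (g' '' O ∩ W), ?_, ?_⟩
    · exact inter_mem (mem_nhdsWithin_of_mem_nhds
        ((hOo.preimage (continuous_const_add (v - y))).mem_nhds hvO)) self_mem_nhdsWithin
    · refine measure_mono_null (t := (fun z => (v - y) + z) ⁻¹' (O ∩ g' ⁻¹' W)) ?_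
        (by rw [measure_preimage_add]; exact hOnull)
      rintro z ⟨hz, hz'⟩
      refine ⟨hz, ?_⟩
      have : g' (v - y + z) = g' z := by simp [hvy]
      simpa [this] using hz'.2
  exact g'.toLinearMap.addHaar_eq_zero_of_preimage μ ν hg' hpre

end Submersion

/-- If `f` and `g` are submersions at `a`, and near `a` the values of `f` lie in a null set wherever
those of `g` lie in `W`, then `W` is null near `g a`. -/
theorem exists_nhds_volume_inter_eq_zero {E F ι : Type*} [NormedAddCommGroup E] [NormedSpace ℝ E]
    [FiniteDimensional ℝ E] [NormedAddCommGroup F] [NormedSpace ℝ F] [FiniteDimensional ℝ F]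
    [Fintype ι] {f : E → F} {f' : E →L[ℝ] F} {g : E → ι → ℝ} {g' : E →L[ℝ] ι → ℝ} {a : E}
    (hf : HasStrictFDerivAt f f' a) (hf' : Function.Surjective f')
    (hg : HasStrictFDerivAt g g' a) (hg' : Function.Surjective g')
    {Z : Set F} (hZ : IsClosed Z) {x : F} (hline : ∀ y, {t : ℝ | x + t • y ∈ Z}.Countable)
    {W : Set (ι → ℝ)} (hW : ∀ᶠ b in 𝓝 a, g b ∈ W → f b ∈ Z) :
    ∃ V ∈ 𝓝 (g a), volume (V ∩ W) = 0 := by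
  let _ : MeasurableSpace E := borel E
  let _ : MeasurableSpace F := borel F
  have : BorelSpace E := ⟨rfl⟩
  have : BorelSpace F := ⟨rfl⟩
  obtain ⟨s, hs, h0⟩ := exists_nhds_addHaar_inter_preimage_eq_zero Measure.addHaar
    Measure.addHaar hf hf' (addHaar_eq_zero_of_countable_line_inter _ hZ x hline)
  refine exists_nhds_addHaar_inter_eq_zero Measure.addHaar volume hg hg' (inter_mem hs hW)
    (measure_mono_null ?_ h0)
  rintro b ⟨⟨hbs, hb⟩, hbW⟩
  exact ⟨hbs, hb hbW⟩

end SVAR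

/-! ### Generalized cross products, and the polynomial vectors `crossVec`. -/

namespace SVAR

open Filter Topology

section Adjugate

variable {ι R : Type*} [Fintype ι] [DecidableEq ι]

/-- The `j`-th column of the adjugate serves as the generalized cross product of the rows other than
the `j`-th. -/
theorem dotProduct_col_adjugate [CommRing R] (T : Matrix ι ι R) {i j : ι} (hij : i ≠ j) :
    T i ⬝ᵥ T.adjugate.col j = 0 := by
  have h := congrFun (congrFun T.mul_adjugate i) j
  rw [Matrix.smul_apply, Matrix.one_apply_ne hij, smul_zero] at h
  exact h

theorem dotProduct_col_adjugate_eq_det [CommRing R] (T : Matrix ι ι R) (p : ι → R) (j : ι) :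
    p ⬝ᵥ T.adjugate.col j = (T.updateRow j p).det := by
  have h := congrFun (congrFun (T.updateRow j p).mul_adjugate j) j
  rw [Matrix.smul_apply, Matrix.one_apply_eq, smul_eq_mul, mul_one, Matrix.mul_apply] at h
  rw [← h, dotProduct]
  refine Finset.sum_congr rfl fun a _ => ?_
  simp [Matrix.adjugate_apply]

theorem col_adjugate_diagonal_mul [CommRing R] (d : ι → R) (T : Matrix ι ι R) (j : ι) :
    (Matrix.diagonal d * T).adjugate.col j
      = (∏ i ∈ Finset.univ.erase j, d i) • T.adjugate.col j := by
  ext a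
  rw [Matrix.adjugate_mul_distrib, Matrix.adjugate_diagonal]
  simp [Matrix.mul_diagonal, mul_comm]

variable [Field R]

/-- If the coordinate `v a` of the cross product `v` is nonzero, replacing row `j` by the unit
vector `e_a` gives an invertible matrix. It annihilates `x - (x a / v a) • v`. -/
theorem exists_eq_smul_col_adjugate {T : Matrix ι ι R} {j : ι} (hT : T.adjugate.col j ≠ 0)
    {x : ι → R} (hx : ∀ i, i ≠ j → T i ⬝ᵥ x = 0) : ∃ c : R, x = c • T.adjugate.col j := by
  obtain ⟨a, ha⟩ := Function.ne_iff.1 hT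
  set v := T.adjugate.col j with hv
  have hdet : (T.updateRow j (Pi.single a 1)).det ≠ 0 := by
    rw [← Matrix.adjugate_apply]
    exact ha
  refine ⟨x a / v a, ?_⟩
  have hva : v a ≠ 0 := ha
  have h0 : (T.updateRow j (Pi.single a 1)) *ᵥ (x - (x a / v a) • v) = 0 := by
    ext i
    rw [Matrix.mulVec]
    by_cases hij : i = j
    · subst hij
      simp [hva]
    · rw [Matrix.updateRow_ne hij, dotProduct_sub, dotProduct_smul, hx i hij,
        dotProduct_col_adjugate T hij]
      simp
  exact sub_eq_zero.1 (Matrix.eq_zero_of_mulVec_eq_zero hdet h0)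

/-- If the cross product vanished at a coordinate `a` with `p a ≠ 0`, the matrix with row `j`
replaced by `e_a` would be singular. A kernel vector would be `c • p` with `c * p a = 0`, hence
zero. -/
theorem col_adjugate_ne_zero {T : Matrix ι ι R} {j : ι} {p : ι → R} (hp : p ≠ 0)
    (hT : ∀ x, (∀ i, i ≠ j → T i ⬝ᵥ x = 0) → ∃ c : R, x = c • p) : T.adjugate.col j ≠ 0 := by
  obtain ⟨a, ha⟩ := Function.ne_iff.1 hp
  refine Function.ne_iff.2 ⟨a, ?_⟩
  change T.adjugate a j ≠ 0
  rw [Matrix.adjugate_apply]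
  intro hdet
  obtain ⟨y, hy0, hy⟩ := Matrix.exists_mulVec_eq_zero_iff.2 hdet
  obtain ⟨c, rfl⟩ := hT y fun i hij => by
    have := congrFun hy i
    rwa [Matrix.mulVec, Matrix.updateRow_ne hij] at this
  have h := congrFun hy j
  rw [Matrix.mulVec, Matrix.updateRow_self, single_one_dotProduct] at h
  have hc : c = 0 := (mul_eq_zero.1 h).resolve_right ha
  simp [hc] at hy0

end Adjugate

theorem rank_eq_pred_iff {n : ℕ} {ι : Type*} [Fintype ι] {M : Matrix ι (Fin n) ℝ}
    {p : Fin n → ℝ} (hp : p ≠ 0) (hM : M *ᵥ p = 0) :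
    M.rank = n - 1 ↔ ∀ x, M *ᵥ x = 0 → ∃ c : ℝ, x = c • p := by
  have hn : 0 < n := by
    rcases Nat.eq_zero_or_pos n with rfl | h
    · exact absurd (Subsingleton.elim _ _) hp
    · exact h
  have h := M.mulVecLin.finrank_range_add_finrank_ker
  rw [Module.finrank_fin_fun] at h
  have hrank : M.rank = n - 1 ↔ Module.finrank ℝ M.mulVecLin.ker = 1 := by
    rw [Matrix.rank]
    omega
  rw [hrank, finrank_eq_one_iff_of_nonzero' (⟨p, hM⟩ : M.mulVecLin.ker)
    (by simpa [Subtype.ext_iff] using hp)]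
  constructor
  · intro H x hx
    obtain ⟨c, hc⟩ := H ⟨x, hx⟩
    exact ⟨c, (congrArg Subtype.val hc).symm⟩
  · rintro H ⟨x, hx⟩
    obtain ⟨c, hc⟩ := H x hx
    exact ⟨c, Subtype.ext hc.symm⟩

/-- The vectors `v_j` defined successively as the generalized cross product of the vectors `v_i`,
`i < j`, and the rows `i > j` of `S_j X`. They are polynomial in `X`. -/
def crossVec {R : Type*} [CommRing R] {n k : ℕ} (S : Fin n → Matrix (Fin n) (Fin k) R)
    (X : Matrix (Fin k) (Fin n) R) (j : Fin n) : Fin n → R :=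
  (Matrix.of fun i => if _h : i < j then crossVec S X i else (S j * X) i).adjugate.col j
termination_by j.val

/-- The matrix whose `i`-th row is that of `V` if `i < j`, and that of `A` otherwise. -/
def stackRows {R : Type*} {n : ℕ} (V : Fin n → Fin n → R) (A : Matrix (Fin n) (Fin n) R)
    (j : Fin n) : Matrix (Fin n) (Fin n) R :=
  Matrix.of fun i => if i < j then V i else A i

theorem stackRows_of_lt {R : Type*} {n : ℕ} (V : Fin n → Fin n → R)
    (A : Matrix (Fin n) (Fin n) R) {i j : Fin n} (h : i < j) : stackRows V A j i = V i :=
  if_pos h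

theorem stackRows_of_not_lt {R : Type*} {n : ℕ} (V : Fin n → Fin n → R)
    (A : Matrix (Fin n) (Fin n) R) {i j : Fin n} (h : ¬i < j) : stackRows V A j i = A i :=
  if_neg h

theorem crossVec_eq {R : Type*} [CommRing R] {n k : ℕ} (S : Fin n → Matrix (Fin n) (Fin k) R)
    (X : Matrix (Fin k) (Fin n) R) (j : Fin n) :
    crossVec S X j = (stackRows (crossVec S X) (S j * X) j).adjugate.col j := by
  rw [crossVec]
  rfl

/-- Naturality in the ring gives polynomial dependence along lines: compute over `ℝ[t]`, then
evaluate. -/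
theorem crossVec_map {R R' : Type*} [CommRing R] [CommRing R'] (φ : R →+* R') {n k : ℕ}
    (S : Fin n → Matrix (Fin n) (Fin k) R) (X : Matrix (Fin k) (Fin n) R) (j a : Fin n) :
    crossVec (fun i => (S i).map φ) (X.map φ) j a = φ (crossVec S X j a) := by
  induction j using WellFoundedLT.induction generalizing a with
  | ind j ih =>
    have h : stackRows (crossVec (fun i => (S i).map φ) (X.map φ)) ((S j).map φ * X.map φ) j
        = (stackRows (crossVec S X) (S j * X) j).map φ := by
      ext i b
      by_cases hij : i < j
      · rw [Matrix.map_apply, stackRows_of_lt _ _ hij, stackRows_of_lt _ _ hij, ih i hij]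
      · rw [Matrix.map_apply, stackRows_of_not_lt _ _ hij, stackRows_of_not_lt _ _ hij,
          ← Matrix.map_mul, Matrix.map_apply]
    rw [crossVec_eq, crossVec_eq, h]
    exact congrFun (congrFun (φ.map_adjugate (stackRows (crossVec S X) (S j * X) j)).symm a) j

theorem exists_polynomial_crossVec {n k : ℕ} (S : Fin n → Matrix (Fin n) (Fin k) ℝ)
    (X Y : Matrix (Fin k) (Fin n) ℝ) (j a : Fin n) :
    ∃ p : Polynomial ℝ, ∀ t : ℝ, crossVec S (X + t • Y) j a = p.eval t := by
  refine ⟨crossVec (fun i => (S i).map Polynomial.C)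
    (X.map Polynomial.C + (Polynomial.X : Polynomial ℝ) • Y.map Polynomial.C) j a, fun t => ?_⟩
  rw [← Polynomial.coe_evalRingHom, ← crossVec_map]
  congr 1
  · ext i b c
    simp
  · ext b c
    simp
    exact mul_comm _ _

theorem continuous_crossVec {n k : ℕ} (S : Fin n → Matrix (Fin n) (Fin k) ℝ) (j : Fin n) :
    Continuous fun X => crossVec S X j := by
  induction j using WellFoundedLT.induction with
  | ind j ih =>
    have h : Continuous fun X => stackRows (crossVec S X) (S j * X) j := by
      refine continuous_pi fun i => ?_
      by_cases hij : i < j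
      · simpa only [stackRows_of_lt _ _ hij] using ih i hij
      · have : Continuous fun X : Matrix (Fin k) (Fin n) ℝ => S j * X := by fun_prop
        simp only [stackRows_of_not_lt _ _ hij]
        exact (continuous_apply i).comp this
    rw [funext fun X => crossVec_eq S X j]
    exact continuous_pi fun a => h.matrix_adjugate.matrix_elem a j

theorem isClosed_exists_crossVec_eq_zero {n k : ℕ} (S : Fin n → Matrix (Fin n) (Fin k) ℝ) :
    IsClosed {X | ∃ j, crossVec S X j = 0} := by
  rw [Set.ofPred_exists]
  exact isClosed_iUnion_of_finite fun j => isClosed_eq (continuous_crossVec S j) continuous_const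

theorem countable_line_inter_exists_crossVec_eq_zero {n k : ℕ}
    (S : Fin n → Matrix (Fin n) (Fin k) ℝ) {X : Matrix (Fin k) (Fin n) ℝ}
    (hX : ∀ j, crossVec S X j ≠ 0) (Y : Matrix (Fin k) (Fin n) ℝ) :
    {t : ℝ | X + t • Y ∈ {X | ∃ j, crossVec S X j = 0}}.Countable := by
  have h : {t : ℝ | X + t • Y ∈ {X | ∃ j, crossVec S X j = 0}}
      = ⋃ j, {t : ℝ | crossVec S (X + t • Y) j = 0} := by
    ext t
    simp
  rw [h]
  refine Set.countable_iUnion fun j => ?_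
  obtain ⟨a, ha⟩ := Function.ne_iff.1 (hX j)
  obtain ⟨p, hp⟩ := exists_polynomial_crossVec S X Y j a
  have hp0 : p ≠ 0 := by
    rintro rfl
    exact ha (by simpa using hp 0)
  refine ((p.finite_setOfPred_isRoot hp0).subset fun t ht => ?_).countable
  change p.eval t = 0
  rw [← hp]
  exact congrFun ht a

/-- The rows `i > j` of `S_j` form a basis of the row space of `Q_j`. -/
structure IsRowBasis {n k : ℕ} (Q : Fin n → Matrix (Fin k) (Fin k) ℝ)
    (S : Fin n → Matrix (Fin n) (Fin k) ℝ) : Prop where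
  mulVec_eq_zero_iff : ∀ j y, Q j *ᵥ y = 0 ↔ ∀ i, j < i → (S j *ᵥ y) i = 0
  exists_rightInverse : ∀ j, ∃ R : Matrix (Fin k) (Fin n) ℝ,
    ∀ v i, j < i → (S j *ᵥ (R *ᵥ v)) i = v i

/-- The rank of `Q j` is the number of indices `i > j`, so a row basis exactly fills the rows after
`j`. The other rows are padding. -/
theorem exists_isRowBasis {n k : ℕ} {Q : Fin n → Matrix (Fin k) (Fin k) ℝ}
    (hq : ∀ j : Fin n, (Q j).rank = n - (j.val + 1)) : ∃ S, IsRowBasis Q S := by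
  have hb : ∀ j, Nonempty (Module.Basis {i : Fin n // j < i} ℝ
      (Submodule.span ℝ (Set.range (Q j).row))) := fun j => by
    refine ⟨(Module.finBasis ℝ _).reindex (Fintype.equivOfCardEq ?_)⟩
    rw [Fintype.card_fin, ← Matrix.rank_eq_finrank_span_row, hq, Fintype.card_subtype,
      Finset.filter_lt_eq_Ioi, Fin.card_Ioi]
    omega
  let b := fun j => (hb j).some
  let M : ∀ j, Matrix {i : Fin n // j < i} (Fin k) ℝ := fun j => Matrix.of fun i => (b j i).1
  let S : Fin n → Matrix (Fin n) (Fin k) ℝ :=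
    fun j => Matrix.of fun i => if h : j < i then M j ⟨i, h⟩ else 0
  have hSM : ∀ j (i : Fin n) (h : j < i) y, (S j *ᵥ y) i = (M j *ᵥ y) ⟨i, h⟩ := by
    intro j i h y
    simp [S, Matrix.mulVec, h]
  refine ⟨S, fun j y => ?_, fun j => ?_⟩
  · have h1 : Q j *ᵥ y = 0 ↔ ∀ x ∈ Submodule.span ℝ (Set.range (Q j).row), x ⬝ᵥ y = 0 := by
      constructor
      · intro h x hx
        induction hx using Submodule.span_induction with
        | mem x hx =>
          obtain ⟨i, rfl⟩ := hx
          exact congrFun h i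
        | zero => simp
        | add x x' _ _ hx hx' => rw [add_dotProduct, hx, hx', add_zero]
        | smul c x _ hx => rw [smul_dotProduct, hx, smul_zero]
      · intro h
        ext i
        exact h _ (Submodule.subset_span ⟨i, rfl⟩)
    rw [h1]
    constructor
    · intro h i hi
      rw [hSM j i hi]
      exact h _ (b j ⟨i, hi⟩).2
    · intro h x hx
      have hsum := congrArg Subtype.val ((b j).sum_repr ⟨x, hx⟩)
      simp only [AddSubmonoidClass.coe_finsetSum, SetLike.val_smul] at hsum
      rw [← hsum, sum_dotProduct]
      refine Finset.sum_eq_zero fun i _ => ?_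
      rw [smul_dotProduct]
      have := h i.1 i.2
      rw [hSM j i.1 i.2] at this
      have h' : (b j i).1 ⬝ᵥ y = 0 := this
      rw [h', smul_zero]
  · have hli : LinearIndependent ℝ (M j).row :=
      (b j).linearIndependent.map' (Submodule.subtype _) (Submodule.ker_subtype _)
    have hsurj : Function.Surjective (M j).mulVecLin := by
      rw [← LinearMap.range_eq_top]
      apply Submodule.eq_top_of_finrank_eq
      rw [Module.finrank_fintype_fun_eq_card]
      exact hli.rank_matrix
    obtain ⟨σ, hσ⟩ := (M j).mulVecLin.exists_rightInverse_of_surjective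
      (LinearMap.range_eq_top.2 hsurj)
    refine ⟨LinearMap.toMatrix' (σ ∘ₗ LinearMap.funLeft ℝ ℝ Subtype.val), fun v i hi => ?_⟩
    rw [LinearMap.toMatrix'_mulVec, hSM j i hi]
    exact congrFun (LinearMap.congr_fun hσ (LinearMap.funLeft ℝ ℝ Subtype.val v)) ⟨i, hi⟩

theorem qTilde_mulVec_eq_zero_iff {n k : ℕ} (Q : Fin n → Matrix (Fin k) (Fin k) ℝ)
    (X : Matrix (Fin k) (Fin n) ℝ) (P : Matrix (Fin n) (Fin n) ℝ) (j : Fin n) (x : Fin n → ℝ) :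
    qTilde Q X P j *ᵥ x = 0 ↔ Q j *ᵥ (X *ᵥ x) = 0 ∧ ∀ i < j, P.col i ⬝ᵥ x = 0 := by
  rw [qTilde, Matrix.fromRows_mulVec, Matrix.mulVec_mulVec]
  constructor
  · intro h
    exact ⟨funext fun i => congrFun h (Sum.inl i), fun i hi => congrFun h (Sum.inr ⟨i, hi⟩)⟩
  · rintro ⟨h1, h2⟩
    ext (i | i)
    · exact congrFun h1 i
    · exact h2 i.1 i.2

/-- This replaces `Q̃_j` by a square matrix with the `j`-th row left free, so that cross products
describe its kernel. -/
theorem IsRowBasis.qTilde_mulVec_eq_zero_iff {n k : ℕ} {Q : Fin n → Matrix (Fin k) (Fin k) ℝ}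
    {S : Fin n → Matrix (Fin n) (Fin k) ℝ} (hS : IsRowBasis Q S) (X : Matrix (Fin k) (Fin n) ℝ)
    (P : Matrix (Fin n) (Fin n) ℝ) (j : Fin n) (x : Fin n → ℝ) :
    qTilde Q X P j *ᵥ x = 0 ↔ ∀ i, i ≠ j →
      stackRows P.col (S j * X) j i ⬝ᵥ x = 0 := by
  rw [SVAR.qTilde_mulVec_eq_zero_iff, hS.mulVec_eq_zero_iff]
  constructor
  · rintro ⟨h1, h2⟩ i hij
    rcases lt_or_gt_of_ne hij with h | h
    · rw [stackRows_of_lt _ _ h]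
      exact h2 i h
    · have := h1 i h
      rw [Matrix.mulVec_mulVec] at this
      rw [stackRows_of_not_lt _ _ h.not_gt]
      exact this
  · intro h
    refine ⟨fun i hi => ?_, fun i hi => ?_⟩
    · rw [Matrix.mulVec_mulVec]
      have := h i hi.ne'
      rwa [stackRows_of_not_lt _ _ hi.not_gt] at this
    · have := h i hi.ne
      rwa [stackRows_of_lt _ _ hi] at this

end SVAR

/-! ### Sequential solutions, the rank conditions, and perturbation along a line. -/

namespace SVAR

open Filter Topology

section SequentialSolution

variable {n k : ℕ} {Q : Fin n → Matrix (Fin k) (Fin k) ℝ} {S : Fin n → Matrix (Fin n) (Fin k) ℝ}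
  {X : Matrix (Fin k) (Fin n) ℝ} {P : Matrix (Fin n) (Fin n) ℝ}

theorem IsSequentialSolution.col_ne_zero (hP : IsSequentialSolution Q X P) (j : Fin n) :
    P.col j ≠ 0 := by
  intro h
  have := (hP j).2
  simp [h] at this

theorem IsSequentialSolution.transpose_mul (hP : IsSequentialSolution Q X P) : Pᵀ * P = 1 := by
  have hlt : ∀ i j, i < j → P.col i ⬝ᵥ P.col j = 0 := fun i j hij =>
    ((qTilde_mulVec_eq_zero_iff Q X P j _).1 (hP j).1).2 i hij
  ext i j
  change P.col i ⬝ᵥ P.col j = _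
  rcases lt_trichotomy i j with h | rfl | h
  · rw [hlt i j h, Matrix.one_apply_ne h.ne]
  · rw [(hP i).2, Matrix.one_apply_eq]
  · rw [dotProduct_comm, hlt j i h, Matrix.one_apply_ne h.ne']

/-- Earlier vectors enter the equations for `p_j` only through orthogonality, so by induction `p_i`
may be replaced by its multiple `v_i`. -/
theorem IsSequentialSolution.exists_col_eq_smul_crossVec (hS : IsRowBasis Q S)
    (hX : ∀ j, crossVec S X j ≠ 0) (hP : IsSequentialSolution Q X P) (j : Fin n) :
    ∃ c : ℝ, c ≠ 0 ∧ P.col j = c • crossVec S X j := by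
  induction j using WellFoundedLT.induction with
  | ind j ih =>
    have hker : ∀ i, i ≠ j → stackRows (crossVec S X) (S j * X) j i ⬝ᵥ P.col j = 0 := by
      intro i hij
      have h := (hS.qTilde_mulVec_eq_zero_iff X P j _).1 (hP j).1 i hij
      by_cases hlt : i < j
      · obtain ⟨c, hc, hci⟩ := ih i hlt
        rw [stackRows_of_lt _ _ hlt, hci, smul_dotProduct, smul_eq_mul] at h
        rw [stackRows_of_lt _ _ hlt]
        exact (mul_eq_zero.1 h).resolve_left hc
      · rw [stackRows_of_not_lt _ _ hlt] at h ⊢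
        exact h
    have hXj := hX j
    rw [crossVec_eq] at hXj ⊢
    obtain ⟨c, hc⟩ := exists_eq_smul_col_adjugate hXj hker
    refine ⟨c, ?_, hc⟩
    rintro rfl
    exact hP.col_ne_zero j (by simpa using hc)

theorem IsSequentialSolution.fullRankConditions (hS : IsRowBasis Q S)
    (hX : ∀ j, crossVec S X j ≠ 0) (hP : IsSequentialSolution Q X P) :
    FullRankConditions Q X P := by
  intro j
  rw [rank_eq_pred_iff (hP.col_ne_zero j) (hP j).1]
  intro x hx
  rw [hS.qTilde_mulVec_eq_zero_iff] at hx
  have hker : ∀ i, i ≠ j → stackRows (crossVec S X) (S j * X) j i ⬝ᵥ x = 0 := by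
    intro i hij
    have h := hx i hij
    by_cases hlt : i < j
    · obtain ⟨c, hc, hci⟩ := hP.exists_col_eq_smul_crossVec hS hX i
      rw [stackRows_of_lt _ _ hlt, hci, smul_dotProduct, smul_eq_mul] at h
      rw [stackRows_of_lt _ _ hlt]
      exact (mul_eq_zero.1 h).resolve_left hc
    · rw [stackRows_of_not_lt _ _ hlt] at h ⊢
      exact h
  have hXj := hX j
  obtain ⟨d, hd, hdj⟩ := hP.exists_col_eq_smul_crossVec hS hX j
  rw [crossVec_eq] at hXj hdj
  obtain ⟨c, hc⟩ := exists_eq_smul_col_adjugate hXj hker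
  refine ⟨c / d, ?_⟩
  rw [hdj, smul_smul, div_mul_cancel₀ _ hd]
  exact hc

/-- If the rows of `T (X + t Y)` other than the `j`-th, together with `p`, are linearly independent
for one `t`, then they are so for all small `t ≠ 0`. -/
theorem eventually_det_updateRow_mul_ne_zero (T : Matrix (Fin n) (Fin k) ℝ)
    (X Y : Matrix (Fin k) (Fin n) ℝ) (p : Fin n → ℝ) (j : Fin n) {s : ℝ}
    (hs : ((T * (X + s • Y)).updateRow j p).det ≠ 0) :
    ∀ᶠ t in 𝓝[≠] (0 : ℝ), ((T * (X + t • Y)).updateRow j p).det ≠ 0 := by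
  obtain ⟨r, hr⟩ : ∃ r : Polynomial ℝ,
      ∀ t : ℝ, ((T * (X + t • Y)).updateRow j p).det = r.eval t := by
    refine ⟨((T.map Polynomial.C * (X.map Polynomial.C + (Polynomial.X : Polynomial ℝ) •
      Y.map Polynomial.C)).updateRow j fun a => Polynomial.C (p a)).det, fun t => ?_⟩
    rw [← Polynomial.coe_evalRingHom, RingHom.map_det]
    congr 1
    ext a b
    by_cases ha : a = j
    · subst ha
      simp
    · simp [Matrix.updateRow_ne ha, Matrix.mul_apply, Polynomial.eval_finsetSum, mul_comm t]
  have hr0 : r ≠ 0 := by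
    rintro rfl
    exact hs (by simpa using hr s)
  refine nhdsNE_le_cofinite 0 ?_
  refine (r.finite_setOfPred_isRoot hr0).subset fun t ht => ?_
  change r.eval t = 0
  rw [← hr]
  simpa using ht

/-- The scalars are needed because `crossVec S X` itself may vanish. At the first index the multiple
is exactly `p_j` for small `t ≠ 0`. At later indices the rank condition makes the limiting cross
product nonzero, and continuity of the adjugate applies. -/
theorem exists_tendsto_smul_crossVec (hS : IsRowBasis Q S) (hP : IsSequentialSolution Q X P)
    (hrank : ∀ j : Fin n, 0 < j.val → (qTilde Q X P j).rank = n - 1) {Y : Matrix (Fin k) (Fin n) ℝ}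
    (hY : ∀ j : Fin n, j.val = 0 → Q j *ᵥ (Y *ᵥ P.col j) = 0 ∧
      ∀ᶠ t in 𝓝[≠] (0 : ℝ), ((S j * (X + t • Y)).updateRow j (P.col j)).det ≠ 0) (j : Fin n) :
    ∃ c : ℝ → ℝ, (∀ᶠ t in 𝓝[≠] 0, c t ≠ 0) ∧
      Tendsto (fun t => c t • crossVec S (X + t • Y) j) (𝓝[≠] 0) (𝓝 (P.col j)) := by
  induction j using WellFoundedLT.induction with
  | ind j ih =>
    rcases Nat.eq_zero_or_pos j.val with hj | hj
    · have hlt : ∀ i, ¬i < j := fun i hij => by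
        have : i.val < j.val := hij
        omega
      have hstack : ∀ (V : Fin n → Fin n → ℝ) A, stackRows V A j = A := fun V A =>
        funext fun i => stackRows_of_not_lt V A (hlt i)
      obtain ⟨hYj, hdet⟩ := hY j hj
      have hex : ∀ᶠ t in 𝓝[≠] (0 : ℝ), ∃ c : ℝ,
          c ≠ 0 ∧ c • crossVec S (X + t • Y) j = P.col j := by
        filter_upwards [hdet] with t ht
        have hv : (stackRows (crossVec S (X + t • Y)) (S j * (X + t • Y)) j).adjugate.col j ≠ 0 := by
          intro h0
          have := dotProduct_col_adjugate_eq_det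
            (stackRows (crossVec S (X + t • Y)) (S j * (X + t • Y)) j) (P.col j) j
          rw [h0, dotProduct_zero, hstack] at this
          exact ht this.symm
        have hker : Q j *ᵥ ((X + t • Y) *ᵥ P.col j) = 0 := by
          rw [Matrix.add_mulVec, Matrix.smul_mulVec, Matrix.mulVec_add, Matrix.mulVec_smul, hYj,
            smul_zero, add_zero]
          exact ((qTilde_mulVec_eq_zero_iff Q X P j _).1 (hP j).1).1
        rw [hS.mulVec_eq_zero_iff] at hker
        obtain ⟨c, hc⟩ := exists_eq_smul_col_adjugate hv (x := P.col j) fun i hij => by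
          rw [hstack]
          have := hker i (lt_of_le_of_ne (not_lt.1 (hlt i)) hij.symm)
          rwa [Matrix.mulVec_mulVec] at this
        refine ⟨c, ?_, by rw [crossVec_eq]; exact hc.symm⟩
        rintro rfl
        exact hP.col_ne_zero j (by simpa using hc)
      obtain ⟨c, hc⟩ := hex.choice
      refine ⟨c, hc.mono fun t ht => ht.1, ?_⟩
      exact tendsto_const_nhds.congr' (hc.mono fun t ht => ht.2.symm)
    · have ih' : ∀ i, ∃ c : ℝ → ℝ, i < j → (∀ᶠ t in 𝓝[≠] 0, c t ≠ 0) ∧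
          Tendsto (fun t => c t • crossVec S (X + t • Y) i) (𝓝[≠] 0) (𝓝 (P.col i)) := fun i => by
        by_cases hij : i < j
        · obtain ⟨c, hc⟩ := ih i hij
          exact ⟨c, fun _ => hc⟩
        · exact ⟨0, fun h => absurd h hij⟩
      choose c hc using ih'
      -- Scaling the rows `i < j` by `c i t` makes the stacked matrix converge. On cross products it
      -- only has the effect of a scalar factor.
      let d : ℝ → Fin n → ℝ := fun t i => if i < j then c i t else 1
      have hker : ∀ x, (∀ i, i ≠ j → stackRows P.col (S j * X) j i ⬝ᵥ x = 0) →
          ∃ a : ℝ, x = a • P.col j := fun x hx =>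
        (rank_eq_pred_iff (hP.col_ne_zero j) (hP j).1).1 (hrank j hj) x
          ((hS.qTilde_mulVec_eq_zero_iff X P j x).2 hx)
      have hu := col_adjugate_ne_zero (hP.col_ne_zero j) hker
      obtain ⟨e, he⟩ := exists_eq_smul_col_adjugate hu
        ((hS.qTilde_mulVec_eq_zero_iff X P j _).1 (hP j).1)
      have he0 : e ≠ 0 := by
        rintro rfl
        exact hP.col_ne_zero j (by simpa using he)
      have hXt : Tendsto (fun t : ℝ => S j * (X + t • Y)) (𝓝[≠] 0) (𝓝 (S j * X)) := by
        have h : Continuous fun t : ℝ => S j * (X + t • Y) := by fun_prop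
        have h' := h.tendsto 0
        rw [zero_smul, add_zero] at h'
        exact h'.mono_left nhdsWithin_le_nhds
      have hlim : Tendsto (fun t => Matrix.diagonal (d t) *
          stackRows (crossVec S (X + t • Y)) (S j * (X + t • Y)) j) (𝓝[≠] 0)
          (𝓝 (stackRows P.col (S j * X) j)) := by
        refine tendsto_pi_nhds.2 fun i => ?_
        have hrow : ∀ t, (Matrix.diagonal (d t) *
            stackRows (crossVec S (X + t • Y)) (S j * (X + t • Y)) j) i
            = d t i • stackRows (crossVec S (X + t • Y)) (S j * (X + t • Y)) j i := fun t => by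
          ext a
          simp [Matrix.diagonal_mul]
        simp_rw [hrow]
        by_cases hij : i < j
        · simpa only [stackRows_of_lt _ _ hij, d, if_pos hij] using (hc i hij).2
        · simpa only [stackRows_of_not_lt _ _ hij, d, if_neg hij, one_smul] using
            tendsto_pi_nhds.1 hXt i
      have hadj : Continuous fun A : Matrix (Fin n) (Fin n) ℝ => A.adjugate.col j :=
        continuous_pi fun a => continuous_id.matrix_adjugate.matrix_elem a j
      have hlim' := (hadj.tendsto _).comp hlim
      simp only [Function.comp_def, col_adjugate_diagonal_mul, ← crossVec_eq] at hlim'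
      refine ⟨fun t => e * ∏ i ∈ Finset.univ.erase j, d t i, ?_, ?_⟩
      · have hd : ∀ᶠ t in 𝓝[≠] 0, ∀ i, d t i ≠ 0 := by
          refine eventually_all.2 fun i => ?_
          by_cases hij : i < j
          · simpa only [d, if_pos hij] using (hc i hij).1
          · simp [d, if_neg hij]
        filter_upwards [hd] with t ht
        exact mul_ne_zero he0 (Finset.prod_ne_zero_iff.2 fun i _ => ht i)
      · simp_rw [mul_smul]
        rw [he]
        exact hlim'.const_smul e

theorem exists_forall_crossVec_ne_zero (hS : IsRowBasis Q S) (hP : IsSequentialSolution Q X P)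
    (hrank : ∀ j : Fin n, 0 < j.val → (qTilde Q X P j).rank = n - 1) :
    ∃ X', ∀ j, crossVec S X' j ≠ 0 := by
  choose R hR using hS.exists_rightInverse
  have hYex : ∃ Y : Matrix (Fin k) (Fin n) ℝ, ∀ j : Fin n, j.val = 0 → Q j *ᵥ (Y *ᵥ P.col j) = 0 ∧
      ∀ᶠ t in 𝓝[≠] (0 : ℝ), ((S j * (X + t • Y)).updateRow j (P.col j)).det ≠ 0 := by
    rcases Nat.eq_zero_or_pos n with rfl | hn
    · exact ⟨0, fun j => j.elim0⟩
    let o : Fin n := ⟨0, hn⟩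
    have ho : ∀ i, i ≠ o → o < i := fun i hi => by
      have : i.val ≠ 0 := fun h => hi (Fin.ext h)
      exact Nat.pos_of_ne_zero this
    have hPo : Pᵀ *ᵥ P.col o = (1 : Matrix (Fin n) (Fin n) ℝ).col o := by
      rw [← hP.transpose_mul]
      rfl
    -- At `t = 1` the line reaches `R o * Pᵀ`. There the rows `i > o` of `S o * (X + Y)` are the
    -- vectors `p_i'`. They are orthogonal to `p_o` and together with it form the invertible matrix
    -- `Pᵀ`.
    refine ⟨R o * Pᵀ - X, fun j hj => ?_⟩
    obtain rfl : j = o := Fin.ext hj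
    constructor
    · rw [Matrix.sub_mulVec, Matrix.mulVec_sub,
        ((qTilde_mulVec_eq_zero_iff Q X P o _).1 (hP o).1).1, sub_zero, hS.mulVec_eq_zero_iff]
      intro i hi
      rw [← Matrix.mulVec_mulVec, hR o _ i hi, hPo]
      exact Matrix.one_apply_ne hi.ne'
    · refine eventually_det_updateRow_mul_ne_zero (S o) X (R o * Pᵀ - X) (P.col o) o (s := 1) ?_
      have hPT : (S o * (X + (1 : ℝ) • (R o * Pᵀ - X))).updateRow o (P.col o) = Pᵀ := by
        ext i a
        by_cases hi : i = o
        · subst hi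
          simp
        · rw [Matrix.updateRow_ne hi, one_smul, add_sub_cancel]
          have := hR o (Pᵀ.col a) i (ho i hi)
          rw [Matrix.mulVec_mulVec] at this
          rw [← Matrix.mul_assoc]
          exact this
      rw [hPT, Matrix.det_transpose]
      intro h0
      have := congrArg Matrix.det hP.transpose_mul
      rw [Matrix.det_mul, h0, mul_zero, Matrix.det_one] at this
      exact zero_ne_one this
  obtain ⟨Y, hY⟩ := hYex
  have hne : ∀ᶠ t in 𝓝[≠] (0 : ℝ), ∀ j, crossVec S (X + t • Y) j ≠ 0 := by
    refine eventually_all.2 fun j => ?_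
    obtain ⟨c, -, hc⟩ := exists_tendsto_smul_crossVec hS hP hrank hY j
    filter_upwards [hc.eventually_ne (hP.col_ne_zero j)] with t ht h0
    exact ht (by rw [h0, smul_zero])
  obtain ⟨t, ht⟩ := hne.exists
  exact ⟨_, ht⟩

end SequentialSolution

end SVAR

/-! ### The reduced-form map is a submersion. -/

namespace SVAR

open Filter Topology

section Smoothness

theorem contDiffAt_matrix {E ι κ : Type*} [NormedAddCommGroup E] [NormedSpace ℝ E] [Fintype ι]
    [Fintype κ] {r : WithTop ℕ∞} {F : E → Matrix ι κ ℝ} {x : E} :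
    ContDiffAt ℝ r F x ↔ ∀ i j, ContDiffAt ℝ r (fun y => F y i j) x := by
  refine (contDiffAt_pi (Φ := F)).trans (forall_congr' fun i => ?_)
  exact contDiffAt_pi

theorem _root_.ContDiffAt.matrix_mul {E ι κ l : Type*} [NormedAddCommGroup E] [NormedSpace ℝ E]
    [Fintype ι] [Fintype κ] [Fintype l] {r : WithTop ℕ∞} {F : E → Matrix ι κ ℝ}
    {G : E → Matrix κ l ℝ} {x : E} (hF : ContDiffAt ℝ r F x) (hG : ContDiffAt ℝ r G x) :
    ContDiffAt ℝ r (fun y => F y * G y) x := by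
  rw [contDiffAt_matrix] at *
  intro i j
  simp only [Matrix.mul_apply]
  exact ContDiffAt.sum fun a _ => (hF i a).mul (hG a j)

theorem _root_.ContDiffAt.matrix_det {E ι : Type*} [NormedAddCommGroup E] [NormedSpace ℝ E]
    [Fintype ι] [DecidableEq ι] {r : WithTop ℕ∞} {F : E → Matrix ι ι ℝ} {x : E}
    (hF : ContDiffAt ℝ r F x) : ContDiffAt ℝ r (fun y => (F y).det) x := by
  rw [contDiffAt_matrix] at hF
  simp only [Matrix.det_apply]
  exact ContDiffAt.sum fun σ _ => (contDiffAt_prod fun i _ => hF (σ i) i).const_smul _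

theorem _root_.ContDiffAt.matrix_inv {E ι : Type*} [NormedAddCommGroup E] [NormedSpace ℝ E]
    [Fintype ι] [DecidableEq ι] {r : WithTop ℕ∞} {F : E → Matrix ι ι ℝ} {x : E}
    (hF : ContDiffAt ℝ r F x) (hx : IsUnit (F x)) : ContDiffAt ℝ r (fun y => (F y)⁻¹) x := by
  have hdet := hF.matrix_det
  have hx' : (F x).det ≠ 0 := ((Matrix.isUnit_iff_isUnit_det _).1 hx).ne_zero
  rw [contDiffAt_matrix] at *
  intro i j
  simp only [Matrix.inv_def, Matrix.smul_apply, Ring.inverse_eq_inv', Matrix.adjugate_apply]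
  refine (hdet.inv hx').smul (ContDiffAt.matrix_det (contDiffAt_matrix.2 fun a b => ?_))
  by_cases ha : a = j
  · subst ha
    simp only [Matrix.updateRow_self]
    exact contDiffAt_const
  · simp only [Matrix.updateRow_ne ha]
    exact hF a b

theorem _root_.ContDiffAt.matrix_transpose {E ι κ : Type*} [NormedAddCommGroup E]
    [NormedSpace ℝ E] [Fintype ι] [Fintype κ] {r : WithTop ℕ∞} {F : E → Matrix ι κ ℝ} {x : E}
    (hF : ContDiffAt ℝ r F x) : ContDiffAt ℝ r (fun y => (F y)ᵀ) x := by
  rw [contDiffAt_matrix] at *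
  exact fun i j => hF j i

end Smoothness

variable {n m : ℕ}

theorem contDiffAt_redCoords_toReduced {A : StructParam n m} (hA : A ∈ structSet n m) :
    ContDiffAt ℝ 1 (fun A : StructParam n m => redCoords (toReduced A)) A := by
  have h1 : ContDiffAt ℝ 1 (fun A : StructParam n m => A.1) A := contDiffAt_fst
  have h2 : ContDiffAt ℝ 1 (fun A : StructParam n m => A.2) A := contDiffAt_snd
  have hB := h2.matrix_mul (h1.matrix_inv hA)
  have hS := (h1.matrix_mul h1.matrix_transpose).matrix_inv
    (hA.mul ((Matrix.isUnit_transpose _).2 hA))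
  rw [contDiffAt_matrix] at hB hS
  rw [contDiffAt_pi]
  rintro (q | q)
  · exact hB q.1 q.2
  · exact hS q.1.1 q.1.2

/-- `toReduced` is a submersion, in the coordinates `redCoords`: its composition with
`(B, C) ↦ (C'⁻¹, B C'⁻¹)` is `(B, C) ↦ (B, C C')`. -/
theorem surjective_fderiv_redCoords_toReduced {A : StructParam n m} (hA : A ∈ structSet n m) :
    Function.Surjective (fderiv ℝ (fun A : StructParam n m => redCoords (toReduced A)) A) := by
  let ψ : RedParam n m → StructParam n m := fun θ => (θ.2ᵀ⁻¹, θ.1 * θ.2ᵀ⁻¹)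
  let θ₀ : RedParam n m := (A.2 * A.1⁻¹, A.1ᵀ⁻¹)
  have hdet : IsUnit A.1.det := (Matrix.isUnit_iff_isUnit_det _).1 hA
  have hθ₀ : IsUnit θ₀.2 := (Matrix.isUnit_nonsing_inv_iff).2 ((Matrix.isUnit_transpose _).2 hA)
  have hψ₀ : ψ θ₀ = A := by
    have h : A.1ᵀ⁻¹ᵀ⁻¹ = A.1 := by
      rw [Matrix.transpose_nonsing_inv, Matrix.transpose_transpose,
        Matrix.nonsing_inv_nonsing_inv _ hdet]
    simp only [ψ, θ₀]
    rw [h, Matrix.mul_assoc, Matrix.nonsing_inv_mul _ hdet, Matrix.mul_one]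
  have hψ : DifferentiableAt ℝ ψ θ₀ := by
    have h1 : ContDiffAt ℝ 1 (fun A : RedParam n m => A.1) θ₀ := contDiffAt_fst
    have h2 : ContDiffAt ℝ 1 (fun A : RedParam n m => A.2) θ₀ := contDiffAt_snd
    have h3 := h2.matrix_transpose.matrix_inv ((Matrix.isUnit_transpose _).2 hθ₀)
    exact (h3.prodMk (h1.matrix_mul h3)).differentiableAt one_ne_zero
  have hg := (contDiffAt_redCoords_toReduced hA).differentiableAt one_ne_zero
  have hopen : ∀ᶠ θ in 𝓝 θ₀, IsUnit θ.2 := by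
    have hc : Continuous fun θ : RedParam n m => θ.2.det := continuous_snd.matrix_det
    filter_upwards [hc.continuousAt.eventually_ne
      ((Matrix.isUnit_iff_isUnit_det _).1 hθ₀).ne_zero] with θ hθ
    exact (Matrix.isUnit_iff_isUnit_det _).2 (isUnit_iff_ne_zero.2 hθ)
  have hcomp : (fun θ : RedParam n m => redCoords (toReduced (ψ θ)))
      =ᶠ[𝓝 θ₀] fun θ => redCoords (θ.1, θ.2 * θ.2ᵀ) := by
    filter_upwards [hopen] with θ hθ
    have hd : IsUnit θ.2.det := (Matrix.isUnit_iff_isUnit_det _).1 hθ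
    have hd' : IsUnit θ.2ᵀ.det := by rwa [Matrix.det_transpose]
    congr 1
    simp only [toReduced, ψ]
    rw [Matrix.nonsing_inv_nonsing_inv _ hd', Matrix.mul_assoc, Matrix.nonsing_inv_mul _ hd',
      Matrix.mul_one, ← Matrix.transpose_nonsing_inv, Matrix.transpose_transpose,
      Matrix.mul_inv_rev, Matrix.transpose_nonsing_inv, Matrix.nonsing_inv_nonsing_inv _ hd,
      Matrix.nonsing_inv_nonsing_inv _ hd']
  have hchain : HasFDerivAt (fun θ : RedParam n m => redCoords (θ.1, θ.2 * θ.2ᵀ))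
      ((fderiv ℝ (fun A : StructParam n m => redCoords (toReduced A)) A).comp (fderiv ℝ ψ θ₀))
      θ₀ := by
    refine HasFDerivAt.congr_of_eventuallyEq ?_ hcomp.symm
    have hg' := hg.hasFDerivAt
    rw [← hψ₀] at hg'
    have := hg'.comp θ₀ hψ.hasFDerivAt
    rw [hψ₀] at this
    exact this
  intro y
  -- a symmetric matrix with lower triangular part given by `y`
  let D : Matrix (Fin n) (Fin n) ℝ := Matrix.of fun i j =>
    if h : j ≤ i then y (Sum.inr ⟨(i, j), h⟩) else y (Sum.inr ⟨(j, i), (not_le.1 h).le⟩)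
  have hD : Dᵀ = D := by
    ext i j
    rcases lt_trichotomy i j with h | rfl | h
    · simp [D, h.le, h.not_ge]
    · rfl
    · simp [D, h.le, h.not_ge]
  -- The derivative of `C ↦ C C'` at `C₀ = θ₀.2` in direction `C` is `C C₀' + C₀ C'`. The two terms
  -- are transposes of each other, so each is made to equal half of the symmetric matrix `D`.
  obtain ⟨C, hC⟩ : ∃ C, C * θ₀.2ᵀ = (2⁻¹ : ℝ) • D := by
    refine ⟨(2⁻¹ : ℝ) • (D * θ₀.2ᵀ⁻¹), ?_⟩
    rw [Matrix.smul_mul, Matrix.mul_assoc, Matrix.nonsing_inv_mul, Matrix.mul_one]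
    rw [Matrix.det_transpose]
    exact (Matrix.isUnit_iff_isUnit_det _).1 hθ₀
  have hC' : θ₀.2 * Cᵀ = (2⁻¹ : ℝ) • D := by
    have := congrArg Matrix.transpose hC
    rwa [Matrix.transpose_mul, Matrix.transpose_transpose, Matrix.transpose_smul, hD] at this
  let δ : RedParam n m := (Matrix.of fun i j => y (Sum.inl (i, j)), C)
  refine ⟨fderiv ℝ ψ θ₀ δ, ?_⟩
  -- the derivative along the line through `θ₀` with direction `δ`
  have hline : HasDerivAt (fun t : ℝ => θ₀ + t • δ) δ 0 := by
    have h := ((hasDerivAt_id' (0 : ℝ)).smul_const δ).const_add θ₀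
    rwa [one_smul] at h
  have h1 : HasDerivAt (fun t : ℝ => redCoords ((θ₀ + t • δ).1, (θ₀ + t • δ).2 * (θ₀ + t • δ).2ᵀ))
      (fderiv ℝ (fun A : StructParam n m => redCoords (toReduced A)) A (fderiv ℝ ψ θ₀ δ)) 0 := by
    have h0 : θ₀ + (0 : ℝ) • δ = θ₀ := by simp
    rw [← h0] at hchain
    have := hchain.comp_hasDerivAt (0 : ℝ) hline
    rw [h0] at this
    exact this
  refine h1.unique ?_
  have hδ : δ.2 = C := rfl
  have hS : ∀ t : ℝ, (θ₀ + t • δ).2 * (θ₀ + t • δ).2ᵀ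
      = θ₀.2 * θ₀.2ᵀ + t • D + (t * t) • (C * Cᵀ) := by
    intro t
    rw [Prod.snd_add, Prod.smul_snd, hδ, Matrix.transpose_add, Matrix.transpose_smul, Matrix.add_mul,
      Matrix.mul_add, Matrix.mul_add, Matrix.mul_smul, Matrix.smul_mul, Matrix.smul_mul,
      Matrix.mul_smul, hC, hC']
    module
  rw [hasDerivAt_pi]
  rintro (q | q)
  · have : ∀ t : ℝ, redCoords ((θ₀ + t • δ).1, (θ₀ + t • δ).2 * (θ₀ + t • δ).2ᵀ) (Sum.inl q)
        = θ₀.1 q.1 q.2 + t * y (Sum.inl q) := fun t => rfl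
    simp_rw [this]
    simpa using ((hasDerivAt_id (0 : ℝ)).mul_const (y (Sum.inl q))).const_add (θ₀.1 q.1 q.2)
  · have : ∀ t : ℝ, redCoords ((θ₀ + t • δ).1, (θ₀ + t • δ).2 * (θ₀ + t • δ).2ᵀ) (Sum.inr q)
        = (θ₀.2 * θ₀.2ᵀ) q.1.1 q.1.2 + t * y (Sum.inr q)
          + t * t * (C * Cᵀ) q.1.1 q.1.2 := fun t => by
      rw [hS]
      simp [redCoords, D, q.2]
    simp_rw [this]
    have ht := hasDerivAt_id' (0 : ℝ)
    have h := ((ht.mul_const (y (Sum.inr q))).const_add ((θ₀.2 * θ₀.2ᵀ) q.1.1 q.1.2)).add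
      ((ht.mul ht).mul_const ((C * Cᵀ) q.1.1 q.1.2))
    simp only [one_mul, mul_zero, add_zero, mul_one, zero_mul] at h
    exact h

end SVAR

/-! ### Orthogonal invariance, and the passage to reduced-form parameters. -/

namespace SVAR

open Filter Topology

theorem qTilde_mul {n k : ℕ} (Q : Fin n → Matrix (Fin k) (Fin k) ℝ) (X : Matrix (Fin k) (Fin n) ℝ)
    (P O : Matrix (Fin n) (Fin n) ℝ) (j : Fin n) :
    qTilde Q (X * O) (Oᵀ * P) j = qTilde Q X P j * O := by
  rw [qTilde, qTilde, Matrix.fromRows_mul, Matrix.mul_assoc]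
  congr 1
  ext i a
  simp [Matrix.mul_apply, mul_comm]

theorem IsSequentialSolution.mul_orthogonal {n k : ℕ} {Q : Fin n → Matrix (Fin k) (Fin k) ℝ}
    {X : Matrix (Fin k) (Fin n) ℝ} {P O : Matrix (Fin n) (Fin n) ℝ}
    (hP : IsSequentialSolution Q X P) (hO : O * Oᵀ = 1) :
    IsSequentialSolution Q (X * O) (Oᵀ * P) := by
  intro j
  have hcol : (Oᵀ * P).col j = Oᵀ *ᵥ P.col j := rfl
  constructor
  · rw [qTilde_mul, hcol, Matrix.mulVec_mulVec, Matrix.mul_assoc, hO, Matrix.mul_one]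
    exact (hP j).1
  · rw [hcol, Matrix.dotProduct_mulVec, Matrix.vecMul_transpose, Matrix.mulVec_mulVec, hO,
      Matrix.one_mulVec]
    exact (hP j).2

theorem rank_qTilde_mul {n k : ℕ} (Q : Fin n → Matrix (Fin k) (Fin k) ℝ)
    (X : Matrix (Fin k) (Fin n) ℝ) (P : Matrix (Fin n) (Fin n) ℝ) {O : Matrix (Fin n) (Fin n) ℝ}
    (hO : O * Oᵀ = 1) (j : Fin n) :
    (qTilde Q (X * O) (Oᵀ * P) j).rank = (qTilde Q X P j).rank := by
  rw [qTilde_mul]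
  refine Matrix.rank_mul_eq_left_of_isUnit_det _ _ (isUnit_iff_ne_zero.2 fun h => ?_)
  have := congrArg Matrix.det hO
  rw [Matrix.det_mul, h, zero_mul, Matrix.det_one] at this
  exact zero_ne_one this

variable {n m k : ℕ}

theorem posDef_toReduced {A : StructParam n m} (hA : A ∈ structSet n m) :
    (toReduced A).2.PosDef := by
  have h := Matrix.PosDef.mul_conjTranspose_self A.1 (Matrix.vecMul_injective_of_isUnit hA)
  rw [Matrix.conjTranspose_eq_transpose_of_trivial] at h
  exact h.inv

/-- The coordinates omit the entries above the diagonal, which symmetry of `Σ` recovers. -/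
theorem toReduced_eq_of_redCoords_eq {A A' : StructParam n m} (hA : A ∈ structSet n m)
    (hA' : A' ∈ structSet n m) (h : redCoords (toReduced A) = redCoords (toReduced A')) :
    toReduced A = toReduced A' := by
  have hs : ∀ {A : StructParam n m}, A ∈ structSet n m → ∀ i j,
      (toReduced A).2 i j = (toReduced A).2 j i := fun hA i j => by
    simpa using ((posDef_toReduced hA).isHermitian.apply i j).symm
  refine Prod.ext ?_ ?_
  · ext i j
    exact congrFun h (Sum.inl (i, j))
  · ext i j
    rcases le_total j i with hij | hij
    · exact congrFun h (Sum.inr ⟨(i, j), hij⟩)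
    · rw [hs hA, hs hA']
      exact congrFun h (Sum.inr ⟨(j, i), hij⟩)

/-- A structural parameter differs from the triangular one by an orthogonal matrix. -/
theorem exists_orthogonal_rotate_triangularParam {A : StructParam n m} (hA : A ∈ structSet n m) :
    ∃ O ∈ Matrix.orthogonalGroup (Fin n) ℝ, rotate (triangularParam (toReduced A)) O = A := by
  have hL := (isCholesky_choleskyFactor (posDef_toReduced hA)).mul_transpose
  set L := choleskyFactor (toReduced A).2 with hLdef
  have hA0 : IsUnit A.1.det := (Matrix.isUnit_iff_isUnit_det _).1 hA
  have hA0' : IsUnit A.1ᵀ.det := by rwa [Matrix.det_transpose]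
  have hLdet : IsUnit L.det := by
    have h := (Matrix.isUnit_iff_isUnit_det _).1 (posDef_toReduced hA).isUnit
    rw [← hL, Matrix.det_mul] at h
    exact isUnit_of_mul_isUnit_left h
  have hLdet' : IsUnit Lᵀ.det := by rwa [Matrix.det_transpose]
  have hcancel : L⁻¹ᵀ * (Lᵀ * A.1) = A.1 := by
    rw [← Matrix.mul_assoc, Matrix.transpose_nonsing_inv, Matrix.nonsing_inv_mul _ hLdet',
      Matrix.one_mul]
  have hAA : A.1 * A.1ᵀ = Lᵀ⁻¹ * L⁻¹ := by
    have hu : IsUnit (A.1 * A.1ᵀ).det := by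
      rw [Matrix.det_mul]
      exact hA0.mul hA0'
    rw [← Matrix.mul_inv_rev, hL, toReduced, Matrix.nonsing_inv_nonsing_inv _ hu]
  -- With `O = L' A₀`, orthogonality is the identity `A₀ A₀' = (L L')⁻¹`.
  refine ⟨Lᵀ * A.1, ?_, ?_⟩
  · rw [Matrix.mem_orthogonalGroup_iff]
    change Lᵀ * A.1 * (Lᵀ * A.1)ᵀ = 1
    rw [Matrix.transpose_mul, Matrix.transpose_transpose, Matrix.mul_assoc, ← Matrix.mul_assoc A.1,
      hAA, ← Matrix.mul_assoc, ← Matrix.mul_assoc, Matrix.mul_nonsing_inv _ hLdet',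
      Matrix.one_mul, Matrix.nonsing_inv_mul _ hLdet]
  · refine Prod.ext hcancel ?_
    change (A.2 * A.1⁻¹) * L⁻¹ᵀ * (Lᵀ * A.1) = A.2
    rw [Matrix.mul_assoc, hcancel, Matrix.mul_assoc, Matrix.nonsing_inv_mul _ hA0, Matrix.mul_one]

/-- On the domain of an admissible `f`, the values of `f` at a structural parameter and at the
triangular one differ by an orthogonal matrix. -/
theorem Admissible.exists_orthogonal {U : Set (StructParam n m)}
    {f : StructParam n m → Matrix (Fin k) (Fin n) ℝ} (hU : U ⊆ structSet n m)
    (hadm : Admissible U f) {A : StructParam n m} (hA : A ∈ U) :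
    ∃ O : Matrix (Fin n) (Fin n) ℝ, O * Oᵀ = 1 ∧ Oᵀ * O = 1 ∧
      f A = f (triangularParam (toReduced A)) * O := by
  obtain ⟨O, hO, hrot⟩ := exists_orthogonal_rotate_triangularParam (hU hA)
  have h1 : O * Oᵀ = 1 := (Matrix.mem_orthogonalGroup_iff _ _).1 hO
  have h2 : Oᵀ * O = 1 := (Matrix.mem_orthogonalGroup_iff' _ _).1 hO
  have hO' : Oᵀ ∈ Matrix.orthogonalGroup (Fin n) ℝ := by
    rw [Matrix.mem_orthogonalGroup_iff]
    change Oᵀ * Oᵀᵀ = 1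
    rwa [Matrix.transpose_transpose]
  have htri : rotate A Oᵀ = triangularParam (toReduced A) := by
    conv_lhs => rw [← hrot]
    simp [rotate, Matrix.mul_assoc, h1]
  refine ⟨O, h1, h2, ?_⟩
  rw [← htri, (hadm _ hO' A hA).2, Matrix.mul_assoc, h2, Matrix.mul_one]

/-- The columns of the orthogonal matrix that rotates the triangular parameter to a restricted `A`
form a solution: they are orthonormal, and `Q_j f(A) e_j = 0` is the equation for the `j`-th column.
-/
theorem exists_isSequentialSolution {U N : Set (StructParam n m)} (hU : U ⊆ structSet n m)
    {f : StructParam n m → Matrix (Fin k) (Fin n) ℝ} {Q : Fin n → Matrix (Fin k) (Fin k) ℝ}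
    (hadm : Admissible U f) {θ : RedParam n m} (hθ : θ ∈ generatedSet U N f Q) :
    ∃ P, IsSequentialSolution Q (f (triangularParam θ)) P := by
  obtain ⟨A, ⟨⟨hAU, -⟩, hA⟩, rfl⟩ := hθ
  obtain ⟨O, -, hO, hf⟩ := hadm.exists_orthogonal hU hAU
  have hdot : ∀ i j, O.col i ⬝ᵥ O.col j = (1 : Matrix (Fin n) (Fin n) ℝ) i j := fun i j => by
    rw [← hO]
    rfl
  refine ⟨O, fun j => ⟨?_, by rw [hdot, Matrix.one_apply_eq]⟩⟩
  rw [qTilde_mulVec_eq_zero_iff]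
  refine ⟨?_, fun i hi => by rw [hdot, Matrix.one_apply_ne hi.ne]⟩
  have h := hA j
  rw [hf, ← Matrix.mulVec_mulVec, ← Matrix.mulVec_mulVec, Matrix.mulVec_single_one] at h
  exact h

theorem Regular.surjective_fderiv {U : Set (StructParam n m)}
    {f : StructParam n m → Matrix (Fin k) (Fin n) ℝ} (hreg : Regular U f) {A : StructParam n m}
    (hA : A ∈ U) : Function.Surjective (fderiv ℝ f A) := by
  refine LinearMap.range_eq_top.1 (Submodule.eq_top_of_finrank_eq ?_)
  rw [hreg.rank_deriv A hA, Module.finrank_matrix]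
  simp

theorem Regular.hasStrictFDerivAt {U : Set (StructParam n m)}
    {f : StructParam n m → Matrix (Fin k) (Fin n) ℝ} (hreg : Regular U f) {A : StructParam n m}
    (hA : A ∈ U) : HasStrictFDerivAt f (fderiv ℝ f A) A :=
  (hreg.contDiffOn.contDiffAt (hreg.isOpen.mem_nhds hA)).hasStrictFDerivAt one_ne_zero

/-- If the rank conditions for `j ≥ 2` hold at one point, then all of them hold almost
everywhere. -/
theorem isNull_not_fullRankConditions {U N : Set (StructParam n m)} (hU : U ⊆ structSet n m)
    {f : StructParam n m → Matrix (Fin k) (Fin n) ℝ} {Q : Fin n → Matrix (Fin k) (Fin k) ℝ}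
    (hadm : Admissible U f) (hreg : Regular U f) (hq : ∀ j : Fin n, (Q j).rank = n - (j.val + 1))
    {P : RedParam n m → Matrix (Fin n) (Fin n) ℝ}
    (hP : ∀ θ ∈ generatedSet U N f Q, IsSequentialSolution Q (f (triangularParam θ)) (P θ))
    {θ₀ : RedParam n m} (hθ₀ : θ₀ ∈ generatedSet U N f Q)
    (hrank : ∀ j : Fin n, 0 < j.val →
      (qTilde Q (f (triangularParam θ₀)) (P θ₀) j).rank = n - 1) :
    IsNull {θ ∈ generatedSet U N f Q | ¬FullRankConditions Q (f (triangularParam θ)) (P θ)} := by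
  obtain ⟨S, hS⟩ := exists_isRowBasis hq
  obtain ⟨X, hX⟩ := exists_forall_crossVec_ne_zero hS (hP θ₀ hθ₀) hrank
  refine MeasureTheory.measure_null_of_locally_null _ ?_
  rintro _ ⟨θ, ⟨⟨A, ⟨⟨hAU, -⟩, -⟩, rfl⟩, -⟩, rfl⟩
  obtain ⟨V, hV, hV0⟩ := exists_nhds_volume_inter_eq_zero (hreg.hasStrictFDerivAt hAU)
    (hreg.surjective_fderiv hAU)
    ((contDiffAt_redCoords_toReduced (hU hAU)).hasStrictFDerivAt one_ne_zero)
    (surjective_fderiv_redCoords_toReduced (hU hAU)) (isClosed_exists_crossVec_eq_zero S)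
    (countable_line_inter_exists_crossVec_eq_zero S hX)
    (W := redCoords '' {θ ∈ generatedSet U N f Q |
      ¬FullRankConditions Q (f (triangularParam θ)) (P θ)})
    (by
      -- The point `x` ranges over all of `U` near `A`, not only over restricted parameters. If no
      -- `crossVec` vanished at `f x`, rotating `P θ` would give a sequential solution for `f x`,
      -- forcing the full rank conditions at `θ`.
      filter_upwards [hreg.isOpen.mem_nhds hAU] with x hxU hx
      obtain ⟨θ, ⟨hθ, hbad⟩, hθx⟩ := hx
      obtain rfl : θ = toReduced x := by
        obtain ⟨A', ⟨⟨hA'U, -⟩, -⟩, rfl⟩ := id hθ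
        exact toReduced_eq_of_redCoords_eq (hU hA'U) (hU hxU) hθx
      by_contra hx
      refine hbad fun j => ?_
      obtain ⟨O, hO, -, hf⟩ := hadm.exists_orthogonal hU hxU
      rw [← rank_qTilde_mul Q _ _ hO j, ← hf]
      have hsol := (hP _ hθ).mul_orthogonal hO
      rw [← hf] at hsol
      exact hsol.fullRankConditions hS (fun j hj => hx ⟨j, hj⟩) j)
  refine ⟨V ∩ _, ?_, hV0⟩
  rw [Set.inter_comm]
  exact inter_mem_nhdsWithin _ hV

end SVAR

theorem theorem2 (n m k : ℕ)
    (U N : Set (SVAR.StructParam n m)) (hU : U ⊆ SVAR.structSet n m)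
    (f : SVAR.StructParam n m → Matrix (Fin k) (Fin n) ℝ)
    (Q : Fin n → Matrix (Fin k) (Fin k) ℝ)
    (hadm : SVAR.Admissible U f) (hreg : SVAR.Regular U f)
    (hN : SVAR.IsNormalization N)
    (hq : ∀ j : Fin n, (Q j).rank = n - (j.val + 1)) :
    -- the vectors `p_1, …, p_n` exist at every generated reduced-form parameter
    (∀ θ ∈ SVAR.generatedSet U N f Q,
      ∃ P, SVAR.IsSequentialSolution Q (f (SVAR.triangularParam θ)) P) ∧
    -- the dichotomy, whichever solution `P θ` is used at each point `θ`
    ∀ P : SVAR.RedParam n m → Matrix (Fin n) (Fin n) ℝ,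
      (∀ θ ∈ SVAR.generatedSet U N f Q,
        SVAR.IsSequentialSolution Q (f (SVAR.triangularParam θ)) (P θ)) →
      (SVAR.nonRedundantSet U N f Q P = ∅ ∨
        SVAR.IsNull (SVAR.generatedSet U N f Q \ SVAR.nonRedundantSet U N f Q P)) ∧
      (SVAR.fullRankSet U N f Q P = ∅ ∨
        SVAR.IsNull (SVAR.generatedSet U N f Q \ SVAR.fullRankSet U N f Q P)) := by
  refine ⟨fun θ hθ => SVAR.exists_isSequentialSolution hU hadm hθ, fun P hP => ⟨?_, ?_⟩⟩
  -- With this identity, non-redundancy is the full rank conditions without the one at the first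
  -- index. One point of `K` thus supplies just the ranks that the null-set result needs, and its
  -- conclusion covers every index.
  · have hsum : ∀ j : Fin n, (Q j).rank + j.val = n - 1 := fun j => by
      rw [hq]
      omega
    refine (Set.eq_empty_or_nonempty _).imp_right fun ⟨θ₀, hθ₀, h⟩ => ?_
    refine MeasureTheory.measure_mono_null (Set.image_mono ?_)
      (SVAR.isNull_not_fullRankConditions hU hadm hreg hq hP hθ₀ fun j hj =>
        (h j hj).trans (hsum j))
    rintro θ ⟨hθ, hθK⟩
    exact ⟨hθ, fun hfull => hθK ⟨hθ, fun j _ => (hfull j).trans (hsum j).symm⟩⟩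
  · refine (Set.eq_empty_or_nonempty _).imp_right fun ⟨θ₀, hθ₀, h⟩ => ?_
    refine MeasureTheory.measure_mono_null (Set.image_mono ?_)
      (SVAR.isNull_not_fullRankConditions hU hadm hreg hq hP hθ₀ fun j _ => h j)
    rintro θ ⟨hθ, hθK⟩
    exact ⟨hθ, fun hfull => hθK ⟨hθ, hfull⟩⟩
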